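/- Fix a probability space $(\Omega,\mathcal A,\mathbb P)$, and write $\mathcal B_B(X)$ for the bounded Borel subsets of a Euclidean space $X$. A \emph{real measure} on $X$ is a $\sigma$-additive function $\mathcal B_B(X)\to\mathbb R$. A \emph{random measure} on $X$ is a $\sigma$-additive function $M:\mathcal B_B(X)\to L^2(\Omega,\mathcal A,\mathbb P)$ (real-valued) for which there is a real measure $C_M$ on $X\times X$, its \emph{covariance measure}, with $C_M(A\times B)=\operatorname{Cov}(M(A),M(B))$ for all $A,B\in\mathcal B_B(X)$; its \emph{mean measure} is $m_M(A)=\mathbb E(M(A))$, and $M$ is \emph{centred} if $m_M=0$. Let $M_1$ and $M_2$ be random measures on $\mathbb R^d$ and $\mathbb R^p$ that are jointly Gaussian, i.e. every vector $(M_1(A_1),\dots,M_1(A_n),M_2(B_1),\dots,M_2(B_m))$ with $A_i\in\mathcal B_B(\mathbb R^d)$, $B_j\in\mathcal B_B(\mathbb R^p)$ is a (possibly degenerate) Gaussian vector. Suppose that there is a real measure $C_{M_1,M_2}$ on $\mathbb R^d\times\mathbb R^p$ with $\operatorname{Cov}(M_1(A),M_2(B))=C_{M_1,M_2}(A\times B)$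 for all $A\in\mathcal B_B(\mathbb R^d)$, $B\in\mathcal B_B(\mathbb R^p)$. Then: (1) There is a unique random measure $M_1\otimes M_2$ on $\mathbb R^d\times\mathbb R^p$ such that $$(M_1\otimes M_2)(A\times B)=M_1(A)\,M_2(B)\quad\text{a.s.},\qquad \forall A\in\mathcal B_B(\mathbb R^d),\ B\in\mathcal B_B(\mathbb R^p).$$ (2) There are unique real measures $C_{M_1}\text{``}\otimes\text{''}C_{M_2}$ and $C_{M_1,M_2}\text{``}\otimes\text{''}C_{M_1,M_2}$ on $(\mathbb R^d\times\mathbb R^p)\times(\mathbb R^d\times\mathbb R^p)$ such that, for all $A_1,A_2\in\mathcal B_B(\mathbb R^d)$ and $B_1,B_2\in\mathcal B_B(\mathbb R^p)$, $$(C_{M_1}\text{``}\otimes\text{''}C_{M_2})(A_1\times B_1\times A_2\times B_2)=C_{M_1}(A_1\times A_2)\,C_{M_2}(B_1\times B_2),$$ $$(C_{M_1,M_2}\text{``}\otimes\text{''}C_{M_1,M_2})(A_1\times B_1\times A_2\times B_2)=C_{M_1,M_2}(A_1\times B_2)\,C_{M_1,M_2}(A_2\times B_1).$$ (3) If $M_1$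 and $M_2$ are centred, then $$m_{M_1\otimes M_2}=C_{M_1,M_2},\qquad C_{M_1\otimes M_2}=C_{M_1}\text{``}\otimes\text{''}C_{M_2}+C_{M_1,M_2}\text{``}\otimes\text{''}C_{M_1,M_2}.$$ -/

import Mathlib

open MeasureTheory ProbabilityTheory

/-- Bounded Borel sets (on `ℝ^d`, or on `ℝ^d × ℝ^p`, which carries the product `σ`-algebra and the
product bornology). -/
def IsBoundedBorel {X : Type*} [MeasurableSpace X] [Bornology X] (A : Set X) : Prop :=
  MeasurableSet A ∧ Bornology.IsBounded A

/-- A `σ`-additive `V`-valued function on the `δ`-ring of bounded Borel sets of `X`.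
As for `MeasureTheory.VectorMeasure`, it is extended by `0` to all other sets, so that two of them
are equal exactly when they agree on the bounded Borel sets. -/
@[ext]
structure LocalVectorMeasure (X : Type*) [MeasurableSpace X] [Bornology X]
    (V : Type*) [AddCommMonoid V] [TopologicalSpace V] where
  toFun : Set X → V
  eq_zero_of_not' : ∀ A : Set X, ¬ IsBoundedBorel A → toFun A = 0
  hasSum_iUnion' : ∀ A : ℕ → Set X, (∀ n, IsBoundedBorel (A n)) →
    Bornology.IsBounded (⋃ n, A n) → Pairwise (Function.onFun Disjoint A) →
    HasSum (fun n => toFun (A n)) (toFun (⋃ n, A n))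

namespace LocalVectorMeasure

variable {X : Type*} [MeasurableSpace X] [Bornology X]
  {V : Type*} [AddCommMonoid V] [TopologicalSpace V]

instance : CoeFun (LocalVectorMeasure X V) (fun _ => Set X → V) := ⟨toFun⟩

instance [ContinuousAdd V] : Add (LocalVectorMeasure X V) where
  add μ ν :=
    { toFun := fun A => μ A + ν A
      eq_zero_of_not' := fun A hA => by
        rw [μ.eq_zero_of_not' A hA, ν.eq_zero_of_not' A hA, add_zero]
      hasSum_iUnion' := fun A hA hU hd =>
        (μ.hasSum_iUnion' A hA hU hd).add (ν.hasSum_iUnion' A hA hU hd) }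

end LocalVectorMeasure

/-- The real measures on `X`: locally finite signed measures, defined on bounded Borel sets. -/
abbrev RealMeasure (X : Type*) [MeasurableSpace X] [Bornology X] := LocalVectorMeasure X ℝ

/-- A (real, second-order, measure-covariance) random measure on `X`: a `σ`-additive
`L²(Ω, P)`-valued function on the bounded Borel sets, whose covariance is given by a real measure
on `X × X`. -/
@[ext]
structure RandomMeasure {Ω : Type*} [MeasurableSpace Ω] (P : Measure Ω)
    (X : Type*) [MeasurableSpace X] [Bornology X] extends LocalVectorMeasure X (Lp ℝ 2 P) where
  exists_cov' : ∃ C : RealMeasure (X × X), ∀ A B : Set X, IsBoundedBorel A → IsBoundedBorel B →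
    C (A ×ˢ B) = cov[toFun A, toFun B; P]

namespace RandomMeasure

variable {Ω : Type*} [MeasurableSpace Ω] {P : Measure Ω}
  {X : Type*} [MeasurableSpace X] [Bornology X] {Y : Type*} [MeasurableSpace Y] [Bornology Y]

instance : CoeFun (RandomMeasure P X) (fun _ => Set X → Lp ℝ 2 P) := ⟨fun M => M.toFun⟩

/-- The mean measure `A ↦ 𝔼[M A]`. -/
noncomputable def meanMeasure [IsProbabilityMeasure P] (M : RandomMeasure P X) :
    RealMeasure X where
  toFun A := ∫ ω, M A ω ∂P
  eq_zero_of_not' A hA := by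
    rw [M.eq_zero_of_not' A hA, integral_congr_ae (Lp.coeFn_zero ℝ 2 P)]
    simp
  hasSum_iUnion' A hA hU hd := by
    have key : ∀ f : Lp ℝ 2 P, ∫ ω, f ω ∂P = innerSL ℝ
        (indicatorConstLp 2 MeasurableSet.univ (measure_ne_top P Set.univ) (1 : ℝ)) f := by
      intro f
      rw [innerSL_apply_apply, L2.inner_indicatorConstLp_one, setIntegral_univ]
    simp only [key]
    exact (M.hasSum_iUnion' A hA hU hd).mapL _

/-- The covariance measure of `M`: the real measure on `X × X` whose value at `A × B` is
`Cov(M A, M B)`, for bounded Borel sets `A` and `B`. -/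
noncomputable def covMeasure (M : RandomMeasure P X) : RealMeasure (X × X) :=
  M.exists_cov'.choose

theorem covMeasure_prod (M : RandomMeasure P X) {A B : Set X}
    (hA : IsBoundedBorel A) (hB : IsBoundedBorel B) :
    M.covMeasure (A ×ˢ B) = cov[M A, M B; P] :=
  M.exists_cov'.choose_spec A B hA hB

/-- `M` is centred if every `M A` has expectation zero. -/
def IsCentred (M : RandomMeasure P X) : Prop :=
  ∀ A : Set X, IsBoundedBorel A → ∫ ω, M A ω ∂P = 0

/-- `M₁` and `M₂` are jointly Gaussian: all the vectors
`(M₁ A₁, …, M₁ Aₙ, M₂ B₁, …, M₂ Bₘ)`, for bounded Borel sets `Aᵢ`, `Bⱼ`, are (possibly degenerate)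
Gaussian vectors. -/
def JointlyGaussian (M₁ : RandomMeasure P X) (M₂ : RandomMeasure P Y) : Prop :=
  IsGaussianProcess
    (Sum.elim (fun (A : {A : Set X // IsBoundedBorel A}) (ω : Ω) => M₁ A.1 ω)
      (fun (B : {B : Set Y // IsBoundedBorel B}) (ω : Ω) => M₂ B.1 ω)) P

/-- The cross-covariance of `M₁` and `M₂` is given by the real measure `C` on `X × Y`. -/
def IsCrossCovariance (M₁ : RandomMeasure P X) (M₂ : RandomMeasure P Y)
    (C : RealMeasure (X × Y)) : Prop :=
  ∀ (A : Set X) (B : Set Y), IsBoundedBorel A → IsBoundedBorel B →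
    cov[M₁ A, M₂ B; P] = C (A ×ˢ B)

/-- The random measure `M` on `X × Y` satisfies `M (A × B) = M₁ A * M₂ B` almost surely, that is,
as elements of `L²`, for all bounded Borel sets `A` and `B`. -/
def IsTensorProduct (M₁ : RandomMeasure P X) (M₂ : RandomMeasure P Y)
    (M : RandomMeasure P (X × Y)) : Prop :=
  ∀ (A : Set X) (B : Set Y), IsBoundedBorel A → IsBoundedBorel B →
    M (A ×ˢ B) =ᵐ[P] fun ω => M₁ A ω * M₂ B ω

end RandomMeasure

/-- `T` is the reordered product `C₁ "⊗" C₂` of a real measure `C₁` on `X × X` and a real measure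
`C₂` on `Y × Y`. -/
def IsReorderedProduct {X Y : Type*} [MeasurableSpace X] [Bornology X]
    [MeasurableSpace Y] [Bornology Y] (C₁ : RealMeasure (X × X)) (C₂ : RealMeasure (Y × Y))
    (T : RealMeasure ((X × Y) × (X × Y))) : Prop :=
  ∀ (A₁ A₂ : Set X) (B₁ B₂ : Set Y), IsBoundedBorel A₁ → IsBoundedBorel A₂ →
    IsBoundedBorel B₁ → IsBoundedBorel B₂ →
    T ((A₁ ×ˢ B₁) ×ˢ (A₂ ×ˢ B₂)) = C₁ (A₁ ×ˢ A₂) * C₂ (B₁ ×ˢ B₂)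

/-- `T` is the crossed product `C "⊗" C` of a real measure `C` on `X × Y` with itself. -/
def IsCrossedProduct {X Y : Type*} [MeasurableSpace X] [Bornology X]
    [MeasurableSpace Y] [Bornology Y] (C : RealMeasure (X × Y))
    (T : RealMeasure ((X × Y) × (X × Y))) : Prop :=
  ∀ (A₁ A₂ : Set X) (B₁ B₂ : Set Y), IsBoundedBorel A₁ → IsBoundedBorel A₂ →
    IsBoundedBorel B₁ → IsBoundedBorel B₂ →
    T ((A₁ ×ˢ B₁) ×ˢ (A₂ ×ˢ B₂)) = C (A₁ ×ˢ B₂) * C (A₂ ×ˢ B₁)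

/-! By Isserlis' formula, itself the polarisation of the fourth moment of a real Gaussian variable,
the inner products in `L²(P)` of the variables `M₁(A) M₂(B)` are sums of products of means and
covariances. Since a product of real measures is again a real measure, these inner products are the
values of one real measure `T` on the products of two rectangles `A × B`.

On a bounded box, let `ν` be the sum of the two marginals of the total variation of `T`. As
`2 |x y| ≤ x² + y²`, the norm of `∑ cᵢ M₁(Aᵢ) M₂(Bᵢ)` in `L²(P)` is at most that of
`∑ cᵢ 1_{Aᵢ × Bᵢ}` in `L²(ν)`, so `1_{A × B} ↦ M₁(A) M₂(B)` extends to a bounded operator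
`L²(ν) → L²(P)`. Composing it with the vector measure `E ↦ 1_E` gives the tensor product on the box.
The boxes glue, and uniqueness holds throughout, because rectangles form a generating π-system. -/

section BoundedBorel

variable {X Y : Type*} [MeasurableSpace X] [Bornology X] [MeasurableSpace Y] [Bornology Y]

namespace IsBoundedBorel

theorem empty : IsBoundedBorel (∅ : Set X) := ⟨.empty, Bornology.isBounded_empty⟩

theorem inter_left {A K : Set X} (hA : MeasurableSet A) (hK : IsBoundedBorel K) :
    IsBoundedBorel (A ∩ K) :=
  ⟨hA.inter hK.1, hK.2.subset Set.inter_subset_right⟩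

theorem mono {A K : Set X} (hA : MeasurableSet A) (hAK : A ⊆ K) (hK : IsBoundedBorel K) :
    IsBoundedBorel A :=
  ⟨hA, hK.2.subset hAK⟩

theorem prod {A : Set X} {B : Set Y} (hA : IsBoundedBorel A) (hB : IsBoundedBorel B) :
    IsBoundedBorel (A ×ˢ B) :=
  ⟨hA.1.prod hB.1, hA.2.prod hB.2⟩

end IsBoundedBorel

theorem exists_isBoundedBorel_superset [(Bornology.cobounded X).IsMeasurablyGenerated] {E : Set X}
    (hE : Bornology.IsBounded E) : ∃ K, E ⊆ K ∧ IsBoundedBorel K := by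
  obtain ⟨t, ht, htm, htE⟩ :=
    Filter.IsMeasurablyGenerated.exists_measurable_subset (Bornology.isBounded_def.1 hE)
  exact ⟨tᶜ, Set.subset_compl_comm.1 htE, htm.compl, Bornology.isBounded_compl_iff.2 ht⟩

theorem isMeasurablyGenerated_cobounded
    (h : ∀ E : Set X, Bornology.IsBounded E → ∃ K, E ⊆ K ∧ IsBoundedBorel K) :
    (Bornology.cobounded X).IsMeasurablyGenerated where
  exists_measurable_subset s hs := by
    obtain ⟨K, hsK, hK⟩ := h sᶜ (Bornology.isBounded_compl_iff.2 hs)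
    exact ⟨Kᶜ, hK.2, hK.1.compl, Set.compl_subset_comm.1 hsK⟩

instance {X : Type*} [PseudoMetricSpace X] [MeasurableSpace X] [OpensMeasurableSpace X] :
    (Bornology.cobounded X).IsMeasurablyGenerated :=
  isMeasurablyGenerated_cobounded fun E hE =>
    ⟨closure E, subset_closure, measurableSet_closure, hE.closure⟩

theorem exists_isBoundedBorel_prod_superset [(Bornology.cobounded X).IsMeasurablyGenerated]
    [(Bornology.cobounded Y).IsMeasurablyGenerated] {E : Set (X × Y)}
    (hE : Bornology.IsBounded E) :
    ∃ (K : Set X) (L : Set Y), IsBoundedBorel K ∧ IsBoundedBorel L ∧ E ⊆ K ×ˢ L := by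
  obtain ⟨K, hEK, hK⟩ := exists_isBoundedBorel_superset hE.image_fst
  obtain ⟨L, hEL, hL⟩ := exists_isBoundedBorel_superset hE.image_snd
  exact ⟨K, L, hK, hL, fun z hz => ⟨hEK ⟨z, hz, rfl⟩, hEL ⟨z, hz, rfl⟩⟩⟩

instance [(Bornology.cobounded X).IsMeasurablyGenerated]
    [(Bornology.cobounded Y).IsMeasurablyGenerated] :
    (Bornology.cobounded (X × Y)).IsMeasurablyGenerated :=
  isMeasurablyGenerated_cobounded fun _ hE =>
    let ⟨K, L, hK, hL, hEKL⟩ := exists_isBoundedBorel_prod_superset hE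
    ⟨K ×ˢ L, hEKL, hK.prod hL⟩

end BoundedBorel

section Box

variable {X Y V : Type*} [MeasurableSpace X] [MeasurableSpace Y]
  [AddCommGroup V] [TopologicalSpace V]

theorem vectorMeasure_eq_of_subset_prod [T2Space V] {μ ν : VectorMeasure (X × Y) V}
    {K : Set X} {L : Set Y} (hK : MeasurableSet K) (hL : MeasurableSet L)
    (h : ∀ A B, MeasurableSet A → MeasurableSet B → A ⊆ K → B ⊆ L → μ (A ×ˢ B) = ν (A ×ˢ B))
    {E : Set (X × Y)} (hE : MeasurableSet E) (hEKL : E ⊆ K ×ˢ L) : μ E = ν E := by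
  have hbox : ∀ A B, MeasurableSet A → MeasurableSet B →
      μ.restrict (K ×ˢ L) (A ×ˢ B) = ν.restrict (K ×ˢ L) (A ×ˢ B) := fun A B hA hB => by
    rw [VectorMeasure.restrict_apply _ (hK.prod hL) (hA.prod hB),
      VectorMeasure.restrict_apply _ (hK.prod hL) (hA.prod hB), Set.prod_inter_prod]
    exact h _ _ (hA.inter hK) (hB.inter hL) Set.inter_subset_right Set.inter_subset_right
  have hrestrict : μ.restrict (K ×ˢ L) = ν.restrict (K ×ˢ L) := by
    refine VectorMeasure.ext_of_generateFrom _ ?_ generateFrom_prod.symm isPiSystem_prod ?_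
    · rintro - ⟨A, hA, B, hB, rfl⟩
      exact hbox A B hA hB
    · rw [← Set.univ_prod_univ]
      exact hbox _ _ .univ .univ
  rw [← VectorMeasure.restrict_eq_self _ (hK.prod hL) hE hEKL, hrestrict,
    VectorMeasure.restrict_eq_self _ (hK.prod hL) hE hEKL]

/-- The vector measure `ρ` extends the set function `f` from the measurable rectangles in the box
`K × L` to all measurable sets. -/
def ExtendsOnBox (f : Set X → Set Y → V) (K : Set X) (L : Set Y) (ρ : VectorMeasure (X × Y) V) :
    Prop :=
  ∀ A B, MeasurableSet A → MeasurableSet B → A ⊆ K → B ⊆ L → ρ (A ×ˢ B) = f A B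

theorem ExtendsOnBox.eq_of_subset [T2Space V] {f : Set X → Set Y → V} {K K' : Set X}
    {L L' : Set Y} {ρ ρ' : VectorMeasure (X × Y) V} (hρ : ExtendsOnBox f K L ρ)
    (hρ' : ExtendsOnBox f K' L' ρ') (hK : MeasurableSet K) (hL : MeasurableSet L)
    (hK' : MeasurableSet K') (hL' : MeasurableSet L') {E : Set (X × Y)} (hE : MeasurableSet E)
    (h : E ⊆ K ×ˢ L) (h' : E ⊆ K' ×ˢ L') : ρ E = ρ' E := by
  refine vectorMeasure_eq_of_subset_prod (hK.inter hK') (hL.inter hL')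
    (fun A B hA hB hAK hBL => ?_) hE (Set.prod_inter_prod ▸ Set.subset_inter h h')
  rw [Set.subset_inter_iff] at hAK hBL
  rw [hρ A B hA hB hAK.1 hBL.1, hρ' A B hA hB hAK.2 hBL.2]

end Box

namespace LocalVectorMeasure

section Restrict

variable {X V : Type*} [MeasurableSpace X] [Bornology X]

theorem add_apply [AddCommMonoid V] [TopologicalSpace V] [ContinuousAdd V]
    (μ ν : LocalVectorMeasure X V) (A : Set X) : (μ + ν) A = μ A + ν A := rfl

theorem ext_of_isBoundedBorel [AddCommMonoid V] [TopologicalSpace V] {μ ν : LocalVectorMeasure X V}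
    (h : ∀ A, IsBoundedBorel A → μ A = ν A) : μ = ν := by
  ext A
  by_cases hA : IsBoundedBorel A
  · exact h A hA
  · rw [μ.eq_zero_of_not' A hA, ν.eq_zero_of_not' A hA]

variable [AddCommGroup V] [TopologicalSpace V] [IsTopologicalAddGroup V] [T2Space V]

theorem apply_empty (μ : LocalVectorMeasure X V) : μ ∅ = 0 := by
  have h : HasSum (fun _ : ℕ => μ ∅) (μ (⋃ _ : ℕ, ∅)) :=
    μ.hasSum_iUnion' (fun _ => ∅) (fun _ => .empty)
      (by simp only [Set.iUnion_empty, Bornology.isBounded_empty])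
      fun _ _ _ => Set.disjoint_empty _
  exact tendsto_nhds_unique tendsto_const_nhds h.summable.tendsto_atTop_zero

open scoped Classical in
/-- The restriction `A ↦ μ (A ∩ K)` to a bounded Borel set `K`, as a vector measure on all of
`X`. -/
noncomputable def restrict (μ : LocalVectorMeasure X V) {K : Set X} (hK : IsBoundedBorel K) :
    VectorMeasure X V where
  measureOf' A := if MeasurableSet A then μ (A ∩ K) else 0
  empty' := by simp only [Set.empty_inter, apply_empty, ite_self]
  not_measurable' A hA := if_neg hA
  m_iUnion' A hA hd := by
    simp only [hA, MeasurableSet.iUnion hA, if_true, Set.iUnion_inter]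
    exact μ.hasSum_iUnion' _ (fun n => hK.inter_left (hA n))
      (hK.2.subset (Set.iUnion_subset fun n => Set.inter_subset_right))
      fun i j hij => (hd hij).mono Set.inter_subset_left Set.inter_subset_left

theorem restrict_apply (μ : LocalVectorMeasure X V) {K A : Set X} (hK : IsBoundedBorel K)
    (hA : MeasurableSet A) : μ.restrict hK A = μ (A ∩ K) :=
  if_pos hA

theorem restrict_apply_of_subset (μ : LocalVectorMeasure X V) {K A : Set X}
    (hK : IsBoundedBorel K) (hA : MeasurableSet A) (hAK : A ⊆ K) : μ.restrict hK A = μ A := by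
  rw [restrict_apply μ hK hA, Set.inter_eq_left.2 hAK]

end Restrict

section MapRange

variable {X V W : Type*} [MeasurableSpace X] [Bornology X]
  [AddCommMonoid V] [Module ℝ V] [TopologicalSpace V]
  [AddCommMonoid W] [Module ℝ W] [TopologicalSpace W]

/-- The composition of a local vector measure with a continuous linear map between its spaces of
values. -/
def mapRange (φ : V →L[ℝ] W) (μ : LocalVectorMeasure X V) : LocalVectorMeasure X W where
  toFun A := φ (μ A)
  eq_zero_of_not' A hA := by rw [μ.eq_zero_of_not' A hA, map_zero]
  hasSum_iUnion' A hA hU hd := (μ.hasSum_iUnion' A hA hU hd).mapL φ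

theorem mapRange_apply (φ : V →L[ℝ] W) (μ : LocalVectorMeasure X V) (A : Set X) :
    μ.mapRange φ A = φ (μ A) := rfl

end MapRange

section Comap

variable {X Y V : Type*} [MeasurableSpace X] [Bornology X] [MeasurableSpace Y] [Bornology Y]
  [AddCommMonoid V] [TopologicalSpace V]

open scoped Classical in
/-- The local vector measure `A ↦ μ (g A)`, for a map `g` of sets that preserves bounded Borel
sets, countable unions and disjointness. It covers both images under proper maps and sections. -/
noncomputable def comapSet (μ : LocalVectorMeasure Y V) (g : Set X → Set Y)
    (hg : ∀ A, IsBoundedBorel A → IsBoundedBorel (g A))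
    (hgU : ∀ A : ℕ → Set X, g (⋃ n, A n) = ⋃ n, g (A n))
    (hgd : ∀ A B, Disjoint A B → Disjoint (g A) (g B)) : LocalVectorMeasure X V where
  toFun A := if IsBoundedBorel A then μ (g A) else 0
  eq_zero_of_not' A hA := if_neg hA
  hasSum_iUnion' A hA hU hd := by
    have hU' : IsBoundedBorel (⋃ n, A n) := ⟨.iUnion fun n => (hA n).1, hU⟩
    simp only [hA, hU', if_true, hgU]
    exact μ.hasSum_iUnion' _ (fun n => hg _ (hA n)) (hgU A ▸ (hg _ hU').2)
      fun i j hij => hgd _ _ (hd hij)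

/-- The section `A ↦ μ (A × B)` of a local vector measure on a product. -/
noncomputable def sectionLeft (μ : LocalVectorMeasure (X × Y) V) {B : Set Y}
    (hB : IsBoundedBorel B) : LocalVectorMeasure X V :=
  μ.comapSet (fun A => A ×ˢ B) (fun _ hA => hA.prod hB) (fun _ => Set.iUnion_prod_const)
    fun _ _ h => Set.Disjoint.set_prod_left h _ _

theorem sectionLeft_apply (μ : LocalVectorMeasure (X × Y) V) {A : Set X} {B : Set Y}
    (hA : IsBoundedBorel A) (hB : IsBoundedBorel B) : μ.sectionLeft hB A = μ (A ×ˢ B) :=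
  if_pos hA

/-- The section `B ↦ μ (A × B)` of a local vector measure on a product. -/
noncomputable def sectionRight (μ : LocalVectorMeasure (X × Y) V) {A : Set X}
    (hA : IsBoundedBorel A) : LocalVectorMeasure Y V :=
  μ.comapSet (fun B => A ×ˢ B) (fun _ hB => hA.prod hB) (fun _ => Set.prod_iUnion)
    fun _ _ h => Set.Disjoint.set_prod_right h _ _

theorem sectionRight_apply (μ : LocalVectorMeasure (X × Y) V) {A : Set X} {B : Set Y}
    (hA : IsBoundedBorel A) (hB : IsBoundedBorel B) : μ.sectionRight hA B = μ (A ×ˢ B) :=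
  if_pos hB

/-- The image of a local vector measure under a measurable map that is proper, in the sense that
preimages of bounded sets are bounded. -/
noncomputable def map (μ : LocalVectorMeasure X V) (φ : X → Y) (hφ : Measurable φ)
    (hφb : ∀ E, Bornology.IsBounded E → Bornology.IsBounded (φ ⁻¹' E)) :
    LocalVectorMeasure Y V :=
  μ.comapSet (fun E => φ ⁻¹' E) (fun _ hE => ⟨hφ hE.1, hφb _ hE.2⟩) (fun _ => Set.preimage_iUnion)
    fun _ _ h => h.preimage φ

theorem map_apply (μ : LocalVectorMeasure X V) {φ : X → Y} (hφ : Measurable φ)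
    (hφb : ∀ E, Bornology.IsBounded E → Bornology.IsBounded (φ ⁻¹' E)) {E : Set Y}
    (hE : IsBoundedBorel E) : μ.map φ hφ hφb E = μ (φ ⁻¹' E) :=
  if_pos hE

end Comap

section Prod

variable {X Y V : Type*} [MeasurableSpace X] [Bornology X] [MeasurableSpace Y] [Bornology Y]
  [(Bornology.cobounded X).IsMeasurablyGenerated] [(Bornology.cobounded Y).IsMeasurablyGenerated]
  [AddCommGroup V] [TopologicalSpace V] [T2Space V]

theorem ext_prod [IsTopologicalAddGroup V] {μ ν : LocalVectorMeasure (X × Y) V}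
    (h : ∀ A B, IsBoundedBorel A → IsBoundedBorel B → μ (A ×ˢ B) = ν (A ×ˢ B)) : μ = ν := by
  refine ext_of_isBoundedBorel fun E hE => ?_
  obtain ⟨K, L, hK, hL, hEKL⟩ := exists_isBoundedBorel_prod_superset hE.2
  rw [← μ.restrict_apply_of_subset (hK.prod hL) hE.1 hEKL,
    ← ν.restrict_apply_of_subset (hK.prod hL) hE.1 hEKL]
  refine vectorMeasure_eq_of_subset_prod hK.1 hL.1 (fun A B hA hB hAK hBL => ?_) hE.1 hEKL
  rw [restrict_apply_of_subset _ _ (hA.prod hB) (Set.prod_mono hAK hBL),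
    restrict_apply_of_subset _ _ (hA.prod hB) (Set.prod_mono hAK hBL)]
  exact h A B (hK.mono hA hAK) (hL.mono hB hBL)

open scoped Classical in
theorem exists_of_forall_extendsOnBox {f : Set X → Set Y → V}
    (h : ∀ K L, IsBoundedBorel K → IsBoundedBorel L → ∃ ρ, ExtendsOnBox f K L ρ) :
    ∃ μ : LocalVectorMeasure (X × Y) V,
      ∀ A B, IsBoundedBorel A → IsBoundedBorel B → μ (A ×ˢ B) = f A B := by
  choose ρ hρ using h
  choose K₀ L₀ hK₀ hL₀ hKL₀ using fun E : {E : Set (X × Y) // IsBoundedBorel E} =>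
    exists_isBoundedBorel_prod_superset E.2.2
  let μ (E : Set (X × Y)) : V :=
    if hE : IsBoundedBorel E then ρ _ _ (hK₀ ⟨E, hE⟩) (hL₀ ⟨E, hE⟩) E else 0
  have hμ {E : Set (X × Y)} (hE : MeasurableSet E) {K : Set X} {L : Set Y} (hK : IsBoundedBorel K)
      (hL : IsBoundedBorel L) (hEKL : E ⊆ K ×ˢ L) : μ E = ρ K L hK hL E := by
    have hE' : IsBoundedBorel E := (hK.prod hL).mono hE hEKL
    exact (dif_pos hE').trans ((hρ _ _ _ _).eq_of_subset (hρ _ _ hK hL) (hK₀ _).1 (hL₀ _).1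
      hK.1 hL.1 hE (hKL₀ ⟨E, hE'⟩) hEKL)
  refine ⟨⟨μ, fun E hE => dif_neg hE, fun E hE hU hd => ?_⟩, fun A B hA hB => ?_⟩
  · obtain ⟨K, L, hK, hL, hEKL⟩ := exists_isBoundedBorel_prod_superset hU
    rw [hμ (.iUnion fun n => (hE n).1) hK hL hEKL]
    simp only [fun n => hμ (hE n).1 hK hL ((Set.subset_iUnion E n).trans hEKL)]
    exact (ρ K L hK hL).m_iUnion (fun n => (hE n).1) hd
  · exact (hμ (hA.1.prod hB.1) hA hB subset_rfl).trans
      (hρ A B hA hB A B hA.1 hB.1 subset_rfl subset_rfl)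

end Prod

end LocalVectorMeasure

section Bimeasure

variable {X Y V : Type*} [MeasurableSpace X] [Bornology X] [MeasurableSpace Y] [Bornology Y]
  [AddCommMonoid V] [TopologicalSpace V]

/-- A bimeasure: a function of pairs of bounded Borel sets that is a local vector measure in each
variable. It need not be induced by a local vector measure on the product. -/
structure IsBimeasure (Φ : Set X → Set Y → V) : Prop where
  exists_left : ∀ B, IsBoundedBorel B →
    ∃ μ : LocalVectorMeasure X V, ∀ A, IsBoundedBorel A → μ A = Φ A B
  exists_right : ∀ A, IsBoundedBorel A →
    ∃ ν : LocalVectorMeasure Y V, ∀ B, IsBoundedBorel B → ν B = Φ A B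

theorem LocalVectorMeasure.isBimeasure (μ : LocalVectorMeasure (X × Y) V) :
    IsBimeasure fun A B => μ (A ×ˢ B) where
  exists_left _ hB := ⟨μ.sectionLeft hB, fun _ hA => μ.sectionLeft_apply hA hB⟩
  exists_right _ hA := ⟨μ.sectionRight hA, fun _ hB => μ.sectionRight_apply hA hB⟩

theorem isBimeasure_inner {H : Type*} [NormedAddCommGroup H] [InnerProductSpace ℝ H]
    (μ : LocalVectorMeasure X H) (ν : LocalVectorMeasure Y H) :
    IsBimeasure fun A B => inner ℝ (μ A) (ν B) where
  exists_left B _ := ⟨μ.mapRange (innerSL ℝ (ν B)), fun _ _ => real_inner_comm _ _⟩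
  exists_right A _ := ⟨ν.mapRange (innerSL ℝ (μ A)), fun _ _ => rfl⟩

end Bimeasure

section BimeasureProd

variable {X Y X' Y' V : Type*} [MeasurableSpace X] [Bornology X] [MeasurableSpace Y] [Bornology Y]
  [MeasurableSpace X'] [Bornology X'] [MeasurableSpace Y'] [Bornology Y']
  [(Bornology.cobounded X).IsMeasurablyGenerated] [(Bornology.cobounded Y).IsMeasurablyGenerated]
  [(Bornology.cobounded X').IsMeasurablyGenerated] [(Bornology.cobounded Y').IsMeasurablyGenerated]
  [AddCommGroup V] [TopologicalSpace V] [IsTopologicalAddGroup V] [T2Space V]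

theorem IsBimeasure.eq_of_forall_prod {Φ Ψ : Set (X × Y) → Set (X' × Y') → V}
    (hΦ : IsBimeasure Φ) (hΨ : IsBimeasure Ψ)
    (h : ∀ A B A' B', IsBoundedBorel A → IsBoundedBorel B → IsBoundedBorel A' →
      IsBoundedBorel B' → Φ (A ×ˢ B) (A' ×ˢ B') = Ψ (A ×ˢ B) (A' ×ˢ B'))
    {E : Set (X × Y)} {F : Set (X' × Y')} (hE : IsBoundedBorel E) (hF : IsBoundedBorel F) :
    Φ E F = Ψ E F := by
  have hrect : ∀ A B, IsBoundedBorel A → IsBoundedBorel B → Φ (A ×ˢ B) F = Ψ (A ×ˢ B) F := by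
    intro A B hA hB
    obtain ⟨μ, hμ⟩ := hΦ.exists_right _ (hA.prod hB)
    obtain ⟨ν, hν⟩ := hΨ.exists_right _ (hA.prod hB)
    have hμν : μ = ν := LocalVectorMeasure.ext_prod fun A' B' hA' hB' => by
      rw [hμ _ (hA'.prod hB'), hν _ (hA'.prod hB'), h A B A' B' hA hB hA' hB']
    rw [← hμ F hF, hμν, hν F hF]
  obtain ⟨μ, hμ⟩ := hΦ.exists_left F hF
  obtain ⟨ν, hν⟩ := hΨ.exists_left F hF
  have hμν : μ = ν := LocalVectorMeasure.ext_prod fun A B hA hB => by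
    rw [hμ _ (hA.prod hB), hν _ (hA.prod hB), hrect A B hA hB]
  rw [← hμ E hE, hμν, hν E hE]

theorem LocalVectorMeasure.ext_prod_prod {μ ν : LocalVectorMeasure ((X × Y) × (X' × Y')) V}
    (h : ∀ A B A' B', IsBoundedBorel A → IsBoundedBorel B → IsBoundedBorel A' →
      IsBoundedBorel B' → μ ((A ×ˢ B) ×ˢ (A' ×ˢ B')) = ν ((A ×ˢ B) ×ˢ (A' ×ˢ B'))) :
    μ = ν :=
  ext_prod fun _ _ hE hF => μ.isBimeasure.eq_of_forall_prod ν.isBimeasure h hE hF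

end BimeasureProd

section RealMeasure

variable {X Y : Type*} [MeasurableSpace X] [Bornology X] [MeasurableSpace Y] [Bornology Y]
  [(Bornology.cobounded X).IsMeasurablyGenerated] [(Bornology.cobounded Y).IsMeasurablyGenerated]

namespace LocalVectorMeasure

theorem exists_prod (μ : RealMeasure X) (ν : RealMeasure Y) :
    ∃ ρ : RealMeasure (X × Y), ∀ A B, IsBoundedBorel A → IsBoundedBorel B →
      ρ (A ×ˢ B) = μ A * ν B := by
  refine exists_of_forall_extendsOnBox (f := fun A B => μ A * ν B) fun K L hK hL =>
    ⟨(μ.restrict hK).prod (ν.restrict hL) (.mul ℝ ℝ), fun A B hA hB hAK hBL => ?_⟩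
  have : IsFiniteMeasure (μ.restrict hK).variation := by
    rw [← SignedMeasure.totalVariation_eq_variation]
    infer_instance
  rw [VectorMeasure.prod_apply, restrict_apply_of_subset μ hK hA hAK,
    restrict_apply_of_subset ν hL hB hBL, ContinuousLinearMap.mul_apply']

/-- The product of two real measures. -/
noncomputable def prod (μ : RealMeasure X) (ν : RealMeasure Y) : RealMeasure (X × Y) :=
  (exists_prod μ ν).choose

theorem prod_apply (μ : RealMeasure X) (ν : RealMeasure Y) {A : Set X} {B : Set Y}
    (hA : IsBoundedBorel A) (hB : IsBoundedBorel B) : μ.prod ν (A ×ˢ B) = μ A * ν B :=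
  (exists_prod μ ν).choose_spec A B hA hB

end LocalVectorMeasure

end RealMeasure

section ReorderedProduct

variable {X Y : Type*} [MeasurableSpace X] [Bornology X] [MeasurableSpace Y] [Bornology Y]
  [(Bornology.cobounded X).IsMeasurablyGenerated] [(Bornology.cobounded Y).IsMeasurablyGenerated]

theorem exists_isReorderedProduct (C₁ : RealMeasure (X × X)) (C₂ : RealMeasure (Y × Y)) :
    ∃ T, IsReorderedProduct C₁ C₂ T := by
  have hbdd (E : Set ((X × Y) × (X × Y))) (hE : Bornology.IsBounded E) :
      Bornology.IsBounded
        ((fun z : (X × X) × (Y × Y) => ((z.1.1, z.2.1), (z.1.2, z.2.2))) ⁻¹' E) := by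
    refine ((hE.image_fst.image_fst.prod hE.image_snd.image_fst).prod
      (hE.image_fst.image_snd.prod hE.image_snd.image_snd)).subset ?_
    rintro ⟨⟨x, x'⟩, y, y'⟩ hz
    exact ⟨⟨⟨_, ⟨_, hz, rfl⟩, rfl⟩, ⟨_, ⟨_, hz, rfl⟩, rfl⟩⟩,
      ⟨_, ⟨_, hz, rfl⟩, rfl⟩, ⟨_, ⟨_, hz, rfl⟩, rfl⟩⟩
  refine ⟨(C₁.prod C₂).map _ (by fun_prop) hbdd, fun A₁ A₂ B₁ B₂ hA₁ hA₂ hB₁ hB₂ => ?_⟩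
  rw [LocalVectorMeasure.map_apply _ _ _ ((hA₁.prod hB₁).prod (hA₂.prod hB₂)),
    ← LocalVectorMeasure.prod_apply C₁ C₂ (hA₁.prod hA₂) (hB₁.prod hB₂)]
  congr 1
  ext z
  exact and_and_and_comm

theorem exists_isCrossedProduct (C : RealMeasure (X × Y)) : ∃ T, IsCrossedProduct C T := by
  have hbdd (E : Set ((X × Y) × (X × Y))) (hE : Bornology.IsBounded E) :
      Bornology.IsBounded
        ((fun z : (X × Y) × (X × Y) => ((z.1.1, z.2.2), (z.2.1, z.1.2))) ⁻¹' E) := by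
    refine ((hE.image_fst.image_fst.prod hE.image_snd.image_snd).prod
      (hE.image_snd.image_fst.prod hE.image_fst.image_snd)).subset ?_
    rintro ⟨⟨x, y⟩, x', y'⟩ hz
    exact ⟨⟨⟨_, ⟨_, hz, rfl⟩, rfl⟩, ⟨_, ⟨_, hz, rfl⟩, rfl⟩⟩,
      ⟨_, ⟨_, hz, rfl⟩, rfl⟩, ⟨_, ⟨_, hz, rfl⟩, rfl⟩⟩
  refine ⟨(C.prod C).map _ (by fun_prop) hbdd, fun A₁ A₂ B₁ B₂ hA₁ hA₂ hB₁ hB₂ => ?_⟩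
  rw [LocalVectorMeasure.map_apply _ _ _ ((hA₁.prod hB₁).prod (hA₂.prod hB₂)),
    ← LocalVectorMeasure.prod_apply C C (hA₁.prod hB₂) (hA₂.prod hB₁)]
  congr 1
  ext z
  simp only [Set.mem_preimage, Set.mem_prod]
  tauto

theorem IsReorderedProduct.unique {C₁ : RealMeasure (X × X)} {C₂ : RealMeasure (Y × Y)}
    {S T : RealMeasure ((X × Y) × (X × Y))} (hS : IsReorderedProduct C₁ C₂ S)
    (hT : IsReorderedProduct C₁ C₂ T) : S = T :=
  LocalVectorMeasure.ext_prod_prod fun A B A' B' hA hB hA' hB' =>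
    (hS A A' B B' hA hA' hB hB').trans (hT A A' B B' hA hA' hB hB').symm

theorem IsCrossedProduct.unique {C : RealMeasure (X × Y)} {S T : RealMeasure ((X × Y) × (X × Y))}
    (hS : IsCrossedProduct C S) (hT : IsCrossedProduct C T) : S = T :=
  LocalVectorMeasure.ext_prod_prod fun A B A' B' hA hB hA' hB' =>
    (hS A A' B B' hA hA' hB hB').trans (hT A A' B B' hA hA' hB hB').symm

end ReorderedProduct

section GaussianMoments

open Polynomial in
theorem iteratedDeriv_eval_mul_exp_eval (p q : ℝ[X]) (n : ℕ) :
    iteratedDeriv n (fun t => q.eval t * Real.exp (p.eval t)) = fun t =>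
      ((fun r => derivative r + r * derivative p)^[n] q).eval t * Real.exp (p.eval t) := by
  induction n generalizing q with
  | zero => rw [iteratedDeriv_zero, Function.iterate_zero, id]
  | succ n ih =>
    rw [iteratedDeriv_succ', Function.iterate_succ_apply, ← ih]
    congr 1 with t
    rw [((q.hasDerivAt t).fun_mul (p.hasDerivAt t).exp).deriv, eval_add, eval_mul]
    ring

open Polynomial in
theorem integral_pow_gaussianReal (m : ℝ) (v : NNReal) (n : ℕ) :
    ∫ x, x ^ n ∂(gaussianReal m v) =
      ((fun r => derivative r + r * (C m + C (v : ℝ) * X))^[n] 1).eval 0 := by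
  have hmgf : mgf (fun x => x) (gaussianReal m v) =
      fun t => (1 : ℝ[X]).eval t * Real.exp ((C m * X + C (v / 2 : ℝ) * X ^ 2).eval t) := by
    rw [mgf_fun_id_gaussianReal]
    ext t
    simp only [eval_one, eval_add, eval_mul, eval_C, eval_X, eval_pow, one_mul]
    ring_nf
  have hderiv : derivative (C m * X + C (v / 2 : ℝ) * X ^ 2) = C m + C (v : ℝ) * X := by
    rw [derivative_add, derivative_C_mul_X, derivative_C_mul_X_pow, Nat.cast_two,
      div_mul_cancel₀ _ two_ne_zero, pow_one]
  have h := iteratedDeriv_mgf_zero (X := fun x => x) (μ := gaussianReal m v) (by simp) n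
  rw [hmgf, iteratedDeriv_eval_mul_exp_eval, hderiv] at h
  simpa using h.symm

open Polynomial in
theorem integral_pow_four_gaussianReal (m : ℝ) (v : NNReal) :
    ∫ x, x ^ 4 ∂(gaussianReal m v) = m ^ 4 + 6 * m ^ 2 * v + 3 * (v : ℝ) ^ 2 := by
  have iterate_four (f : ℝ[X] → ℝ[X]) (q : ℝ[X]) : f^[4] q = f (f (f (f q))) := rfl
  rw [integral_pow_gaussianReal, iterate_four]
  simp only [derivative_add, derivative_mul, derivative_one, derivative_C, derivative_X,
    derivative_zero, eval_add, eval_mul, eval_one, eval_C, eval_X, eval_zero]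
  ring

variable {E : Type*} [NormedAddCommGroup E] [NormedSpace ℝ E] [MeasurableSpace E] [BorelSpace E]

theorem integral_dual_pow_four (μ : Measure E) [IsGaussian μ] (L : StrongDual ℝ E) :
    ∫ x, L x ^ 4 ∂μ = 3 * (∫ x, L x ^ 2 ∂μ) ^ 2 - 2 * (∫ x, L x ∂μ) ^ 4 := by
  have hmap : ∫ x, L x ^ 4 ∂μ = ∫ y, y ^ 4 ∂(μ.map L) := by
    rw [integral_map (by fun_prop) (by fun_prop)]
  rw [hmap, IsGaussian.map_eq_gaussianReal, integral_pow_four_gaussianReal,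
    Real.coe_toNNReal _ (variance_nonneg _ _),
    variance_eq_sub (IsGaussian.memLp_dual μ L 2 ENNReal.ofNat_ne_top)]
  simp only [Pi.pow_apply]
  ring

theorem memLp_two_mul {Ω : Type*} [MeasurableSpace Ω] {P : Measure Ω} {f g : Ω → ℝ}
    (hf : MemLp f 4 P) (hg : MemLp g 4 P) : MemLp (fun ω => f ω * g ω) 2 P := by
  have : ENNReal.HolderTriple 4 4 2 := ⟨by
    rw [← ENNReal.toReal_eq_toReal_iff' (by simp) (by simp), ENNReal.toReal_add (by simp) (by simp)]
    norm_num⟩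
  exact hg.mul' hf

theorem memLp_dual_mul (μ : Measure E) [IsGaussian μ] (L N : StrongDual ℝ E) :
    MemLp (fun x => L x * N x) 2 μ :=
  memLp_two_mul (IsGaussian.memLp_dual μ L 4 ENNReal.ofNat_ne_top)
    (IsGaussian.memLp_dual μ N 4 ENNReal.ofNat_ne_top)

theorem integrable_dual_sq_mul_sq (μ : Measure E) [IsGaussian μ] (L N : StrongDual ℝ E) :
    Integrable (fun x => L x ^ 2 * N x ^ 2) μ := by
  simpa only [mul_pow] using (memLp_dual_mul μ L N).integrable_sq

variable [CompleteSpace E] [SecondCountableTopology E]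

theorem integral_dual_mul_dual (μ : Measure E) [IsGaussian μ] (L N : StrongDual ℝ E) :
    ∫ x, L x * N x ∂μ = uncenteredCovarianceBilinDual μ L N :=
  (uncenteredCovarianceBilinDual_apply IsGaussian.memLp_two_id L N).symm

theorem uncenteredCovarianceBilinDual_comm (μ : Measure E) [IsGaussian μ] (L N : StrongDual ℝ E) :
    uncenteredCovarianceBilinDual μ L N = uncenteredCovarianceBilinDual μ N L := by
  rw [← integral_dual_mul_dual, ← integral_dual_mul_dual]
  simp only [mul_comm]

theorem integral_dual_sq_mul_sq (μ : Measure E) [IsGaussian μ] (L N : StrongDual ℝ E) :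
    ∫ x, L x ^ 2 * N x ^ 2 ∂μ = (∫ x, L x ^ 2 ∂μ) * (∫ x, N x ^ 2 ∂μ)
      + 2 * (∫ x, L x * N x ∂μ) ^ 2 - 2 * ((∫ x, L x ∂μ) * (∫ x, N x ∂μ)) ^ 2 := by
  have hint (L : StrongDual ℝ E) : Integrable (fun x => L x ^ 4) μ := by
    simpa only [← pow_add] using integrable_dual_sq_mul_sq μ L L
  have hpolar : ∫ x, L x ^ 2 * N x ^ 2 ∂μ = ((∫ x, (L + N) x ^ 4 ∂μ) + (∫ x, (L - N) x ^ 4 ∂μ)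
      - 2 * (∫ x, L x ^ 4 ∂μ) - 2 * (∫ x, N x ^ 4 ∂μ)) / 12 := by
    rw [← integral_const_mul, ← integral_const_mul, ← integral_add (hint _) (hint _),
      ← integral_sub (by fun_prop) (by fun_prop), ← integral_sub (by fun_prop) (by fun_prop),
      ← integral_div]
    congr 1 with x
    simp only [add_apply, sub_apply]
    ring
  rw [hpolar]
  simp only [integral_dual_pow_four, sq, integral_dual_mul_dual, IsGaussian.integral_dual]
  simp only [map_add, map_sub, add_apply, sub_apply, uncenteredCovarianceBilinDual_comm μ N L]
  ring

theorem integral_dual_mul_mul_mul (μ : Measure E) [IsGaussian μ] (L₁ L₂ L₃ L₄ : StrongDual ℝ E) :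
    ∫ x, L₁ x * L₂ x * (L₃ x * L₄ x) ∂μ = (∫ x, L₁ x * L₂ x ∂μ) * (∫ x, L₃ x * L₄ x ∂μ)
      + (∫ x, L₁ x * L₃ x ∂μ) * (∫ x, L₂ x * L₄ x ∂μ)
      + (∫ x, L₁ x * L₄ x ∂μ) * (∫ x, L₃ x * L₂ x ∂μ)
      - 2 * ((∫ x, L₁ x ∂μ) * (∫ x, L₂ x ∂μ) * ((∫ x, L₃ x ∂μ) * (∫ x, L₄ x ∂μ))) := by
  have hint := integrable_dual_sq_mul_sq μ
  have hpolar : ∫ x, L₁ x * L₂ x * (L₃ x * L₄ x) ∂μ =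
      ((∫ x, (L₁ + L₂) x ^ 2 * (L₃ + L₄) x ^ 2 ∂μ) - (∫ x, (L₁ + L₂) x ^ 2 * (L₃ - L₄) x ^ 2 ∂μ)
      - ((∫ x, (L₁ - L₂) x ^ 2 * (L₃ + L₄) x ^ 2 ∂μ)
        - (∫ x, (L₁ - L₂) x ^ 2 * (L₃ - L₄) x ^ 2 ∂μ))) / 16 := by
    rw [← integral_sub (hint _ _) (hint _ _), ← integral_sub (hint _ _) (hint _ _),
      ← integral_sub (by fun_prop) (by fun_prop), ← integral_div]
    congr 1 with x
    simp only [add_apply, sub_apply]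
    ring
  rw [hpolar]
  simp only [integral_dual_sq_mul_sq]
  simp only [sq, integral_dual_mul_dual, IsGaussian.integral_dual]
  simp only [map_add, map_sub, add_apply, sub_apply, uncenteredCovarianceBilinDual_comm μ L₂ L₁,
    uncenteredCovarianceBilinDual_comm μ L₃ L₂, uncenteredCovarianceBilinDual_comm μ L₄ L₃]
  ring

end GaussianMoments

section GaussianProcess

variable {Ω T : Type*} [MeasurableSpace Ω] {P : Measure Ω} {X : T → Ω → ℝ}

theorem memLp_mul_of_isGaussianProcess (hX : IsGaussianProcess X P) (s t : T) :
    MemLp (fun ω => X s ω * X t ω) 2 P :=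
  memLp_two_mul ((hX.hasGaussianLaw_eval s).memLp ENNReal.ofNat_ne_top)
    ((hX.hasGaussianLaw_eval t).memLp ENNReal.ofNat_ne_top)

theorem integral_mul_mul_mul_of_isGaussianProcess (hX : IsGaussianProcess X P) (a b c d : T) :
    ∫ ω, X a ω * X b ω * (X c ω * X d ω) ∂P =
      (∫ ω, X a ω * X b ω ∂P) * (∫ ω, X c ω * X d ω ∂P)
      + (∫ ω, X a ω * X c ω ∂P) * (∫ ω, X b ω * X d ω ∂P)
      + (∫ ω, X a ω * X d ω ∂P) * (∫ ω, X c ω * X b ω ∂P)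
      - 2 * ((∫ ω, X a ω ∂P) * (∫ ω, X b ω ∂P) * ((∫ ω, X c ω ∂P) * (∫ ω, X d ω ∂P))) := by
  classical
  let I : Finset T := {a, b, c, d}
  have hI := hX.hasGaussianLaw I
  have := hI.isGaussian_map
  have hμ (g : (I → ℝ) → ℝ) (hg : Measurable g) :
      ∫ x, g x ∂(P.map fun ω => I.restrict (X · ω)) = ∫ ω, g (I.restrict (X · ω)) ∂P :=
    integral_map hI.aemeasurable hg.aestronglyMeasurable
  have h := integral_dual_mul_mul_mul (P.map fun ω => I.restrict (X · ω))
    (.proj ⟨a, by simp [I]⟩) (.proj ⟨b, by simp [I]⟩) (.proj ⟨c, by simp [I]⟩)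
    (.proj ⟨d, by simp [I]⟩)
  simpa (disch := fun_prop) only [hμ, ContinuousLinearMap.proj_apply, Finset.restrict] using h

end GaussianProcess

section IndicatorVectorMeasure

variable {Z : Type*} [MeasurableSpace Z] {ν : Measure Z} [IsFiniteMeasure ν]

theorem sum_indicatorConstLp {A : ℕ → Set Z} (hA : ∀ n, MeasurableSet (A n))
    (hd : Pairwise (Function.onFun Disjoint A)) (S : Finset ℕ) :
    ∑ n ∈ S, indicatorConstLp 2 (hA n) (measure_ne_top ν (A n)) (1 : ℝ) =
      indicatorConstLp 2 (S.measurableSet_biUnion fun n _ => hA n) (measure_ne_top ν _) 1 := by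
  induction S using Finset.induction_on with
  | empty => simp
  | insert a S ha ih =>
    have hdisj : Disjoint (A a) (⋃ n ∈ S, A n) :=
      Set.disjoint_iUnion₂_right.2 fun n hn => hd (ne_of_mem_of_not_mem hn ha).symm
    simp only [Finset.sum_insert ha, ih, ← indicatorConstLp_disjoint_union (hA a)
      (S.measurableSet_biUnion fun n _ => hA n) (measure_ne_top ν _) (measure_ne_top ν _) hdisj,
      Finset.set_biUnion_insert]

theorem tendsto_measure_symmDiff_biUnion_iUnion {A : ℕ → Set Z} (hA : ∀ n, MeasurableSet (A n))
    (hd : Pairwise (Function.onFun Disjoint A)) :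
    Filter.Tendsto (fun S : Finset ℕ => ν (symmDiff (⋃ n ∈ S, A n) (⋃ n, A n))) .atTop
      (nhds 0) := by
  have hdiff (S : Finset ℕ) : ν (symmDiff (⋃ n ∈ S, A n) (⋃ n, A n)) =
      ν (⋃ n, A n) - ∑ n ∈ S, ν (A n) := by
    have hsub : (⋃ n ∈ S, A n) ⊆ ⋃ n, A n := Set.iUnion₂_subset_iUnion _ _
    rw [symmDiff_of_le hsub, measure_sdiff hsub
      (S.measurableSet_biUnion fun n _ => hA n).nullMeasurableSet (measure_ne_top _ _),
      measure_biUnion_finset (fun i _ j _ hij => hd hij) fun n _ => hA n]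
  have hsum : HasSum (fun n => ν (A n)) (ν (⋃ n, A n)) :=
    measure_iUnion hd hA ▸ ENNReal.summable.hasSum
  simp only [hdiff]
  rw [← tsub_self (ν (⋃ n, A n))]
  exact ENNReal.Tendsto.sub tendsto_const_nhds hsum (.inl (measure_ne_top ν _))

open scoped Classical in
/-- The vector measure `E ↦ 1_E` with values in `L²(ν)`. -/
noncomputable def indicatorVectorMeasure (ν : Measure Z) [IsFiniteMeasure ν] :
    VectorMeasure Z (Lp ℝ 2 ν) where
  measureOf' E := if h : MeasurableSet E then indicatorConstLp 2 h (measure_ne_top ν E) 1 else 0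
  empty' := by simp
  not_measurable' E hE := dif_neg hE
  m_iUnion' A hA hd := by
    simp only [hA, MeasurableSet.iUnion hA, dif_pos, HasSum, sum_indicatorConstLp hA hd]
    exact tendsto_indicatorConstLp_set (by simp) (tendsto_measure_symmDiff_biUnion_iUnion hA hd)

theorem indicatorVectorMeasure_apply {E : Set Z} (hE : MeasurableSet E) :
    indicatorVectorMeasure ν E = indicatorConstLp 2 hE (measure_ne_top ν E) 1 :=
  dif_pos hE

theorem inner_indicatorVectorMeasure_left {E : Set Z} (hE : MeasurableSet E) (g : Lp ℝ 2 ν) :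
    inner ℝ (indicatorVectorMeasure ν E) g = ∫ z in E, g z ∂ν := by
  rw [indicatorVectorMeasure_apply hE, L2.inner_indicatorConstLp_one]

theorem inner_indicatorVectorMeasure {E F : Set Z} (hE : MeasurableSet E) (hF : MeasurableSet F) :
    inner ℝ (indicatorVectorMeasure ν E) (indicatorVectorMeasure ν F) = ν.real (E ∩ F) := by
  rw [indicatorVectorMeasure_apply hE, indicatorVectorMeasure_apply hF,
    L2.real_inner_indicatorConstLp_one_indicatorConstLp_one]

theorem denseRange_linearCombination_indicatorVectorMeasure (ν : Measure Z) [IsFiniteMeasure ν]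
    {ι : Type*} {R : ι → Set Z}
    (hgen : ‹MeasurableSpace Z› = MeasurableSpace.generateFrom (Set.range R))
    (hpi : IsPiSystem (Set.range R)) (huniv : Set.univ ∈ Set.range R) :
    DenseRange (Finsupp.linearCombination ℝ fun i => indicatorVectorMeasure ν (R i)) := by
  have hR (i : ι) : MeasurableSet (R i) :=
    hgen ▸ MeasurableSpace.measurableSet_generateFrom ⟨i, rfl⟩
  have horth : (LinearMap.range
      (Finsupp.linearCombination ℝ fun i => indicatorVectorMeasure ν (R i)))ᗮ = ⊥ := by
    refine (Submodule.eq_bot_iff _).2 fun g hg => ?_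
    have hgint : Integrable g ν := (Lp.memLp g).integrable one_le_two
    have hgR (i : ι) : ν.withDensityᵥ g (R i) = 0 := by
      rw [withDensityᵥ_apply hgint (hR i), ← inner_indicatorVectorMeasure_left (hR i)]
      exact (Submodule.mem_orthogonal _ _).1 hg _ ⟨Finsupp.single i 1, by simp⟩
    have hgzero : ν.withDensityᵥ g = ν.withDensityᵥ 0 := by
      rw [withDensityᵥ_zero]
      refine VectorMeasure.ext_of_generateFrom (Set.range R) ?_ hgen hpi ?_
      · rintro - ⟨i, rfl⟩
        exact hgR i
      · obtain ⟨i, hi⟩ := huniv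
        exact hi ▸ hgR i
    exact Lp.ext ((hgint.ae_eq_of_withDensityᵥ_eq (integrable_zero _ _ _) hgzero).trans
      (Lp.coeFn_zero ℝ 2 ν).symm)
  rwa [← Submodule.topologicalClosure_eq_top_iff, ← Submodule.dense_iff_topologicalClosure_eq_top,
    LinearMap.coe_range] at horth

end IndicatorVectorMeasure

section KernelForm

variable {ι : Type*}

/-- The quadratic form `∑ i j, c i * c j * k i j` of a kernel `k`, at a finitely supported
family `c` of coefficients. -/
noncomputable def kernelForm (k : ι → ι → ℝ) (c : ι →₀ ℝ) : ℝ :=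
  c.sum fun i a => c.sum fun j b => a * b * k i j

theorem kernelForm_add (k l : ι → ι → ℝ) (c : ι →₀ ℝ) :
    kernelForm (fun i j => k i j + l i j) c = kernelForm k c + kernelForm l c := by
  simp only [kernelForm, mul_add, Finsupp.sum_add]

theorem kernelForm_sub (k l : ι → ι → ℝ) (c : ι →₀ ℝ) :
    kernelForm (fun i j => k i j - l i j) c = kernelForm k c - kernelForm l c := by
  simp only [kernelForm, mul_sub, Finsupp.sum_sub]

variable {H : Type*} [NormedAddCommGroup H] [InnerProductSpace ℝ H]

theorem kernelForm_inner (u v : ι → H) (c : ι →₀ ℝ) :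
    kernelForm (fun i j => inner ℝ (u i) (v j)) c =
      inner ℝ (Finsupp.linearCombination ℝ u c) (Finsupp.linearCombination ℝ v c) := by
  rw [Finsupp.linearCombination_apply, Finsupp.linearCombination_apply, Finsupp.sum_inner]
  simp only [kernelForm, Finsupp.inner_sum, real_inner_smul_left, real_inner_smul_right, mul_assoc,
    mul_left_comm]

theorem kernelForm_inner_self (u : ι → H) (c : ι →₀ ℝ) :
    kernelForm (fun i j => inner ℝ (u i) (u j)) c = ‖Finsupp.linearCombination ℝ u c‖ ^ 2 := by
  rw [kernelForm_inner, real_inner_self_eq_norm_sq]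

theorem abs_kernelForm_inner_le (u v : ι → H) (c : ι →₀ ℝ) :
    |kernelForm (fun i j => inner ℝ (u i) (v j)) c| ≤
      kernelForm (fun i j => inner ℝ (u i) (u j)) c +
        kernelForm (fun i j => inner ℝ (v i) (v j)) c := by
  rw [kernelForm_inner, kernelForm_inner_self, kernelForm_inner_self]
  refine (abs_real_inner_le_norm _ _).trans ?_
  nlinarith [sq_nonneg (‖Finsupp.linearCombination ℝ u c‖ - ‖Finsupp.linearCombination ℝ v c‖),
    sq_nonneg ‖Finsupp.linearCombination ℝ u c‖, sq_nonneg ‖Finsupp.linearCombination ℝ v c‖]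

variable {Z : Type*} [MeasurableSpace Z]

theorem abs_kernelForm_real_prod_le {R : ι → Set Z} (hR : ∀ i, MeasurableSet (R i))
    (p : Measure (Z × Z)) [IsFiniteMeasure p] (c : ι →₀ ℝ) :
    |kernelForm (fun i j => p.real (R i ×ˢ R j)) c| ≤
      kernelForm (fun i j => (p.fst + p.snd).real (R i ∩ R j)) c := by
  let u (i : ι) := indicatorVectorMeasure p (Prod.fst ⁻¹' R i)
  let v (i : ι) := indicatorVectorMeasure p (Prod.snd ⁻¹' R i)
  have hfst (i : ι) : MeasurableSet (Prod.fst ⁻¹' R i : Set (Z × Z)) := measurable_fst (hR i)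
  have hsnd (i : ι) : MeasurableSet (Prod.snd ⁻¹' R i : Set (Z × Z)) := measurable_snd (hR i)
  have huv (i j : ι) : p.real (R i ×ˢ R j) = inner ℝ (u i) (v j) := by
    rw [inner_indicatorVectorMeasure (hfst i) (hsnd j), Set.prod_eq]
  have hν (i j : ι) : (p.fst + p.snd).real (R i ∩ R j) =
      inner ℝ (u i) (u j) + inner ℝ (v i) (v j) := by
    rw [inner_indicatorVectorMeasure (hfst i) (hfst j),
      inner_indicatorVectorMeasure (hsnd i) (hsnd j), measureReal_add_apply,
      ← Set.preimage_inter, ← Set.preimage_inter]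
    simp only [measureReal_def, Measure.fst_apply ((hR i).inter (hR j)),
      Measure.snd_apply ((hR i).inter (hR j))]
  simpa only [huv, hν, kernelForm_add] using abs_kernelForm_inner_le u v c

end KernelForm

section Gram

variable {Z ι H : Type*} [MeasurableSpace Z] [NormedAddCommGroup H] [InnerProductSpace ℝ H]
  {R : ι → Set Z} {f : ι → H}

theorem exists_norm_linearCombination_le_of_gram (hR : ∀ i, MeasurableSet (R i))
    (T : SignedMeasure (Z × Z)) (hT : ∀ i j, T (R i ×ˢ R j) = inner ℝ (f i) (f j)) :
    ∃ (ν : Measure Z) (_ : IsFiniteMeasure ν), ∀ c : ι →₀ ℝ,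
      ‖Finsupp.linearCombination ℝ f c‖ ≤
        ‖Finsupp.linearCombination ℝ (fun i => indicatorVectorMeasure ν (R i)) c‖ := by
  let p := T.toJordanDecomposition.posPart
  let q := T.toJordanDecomposition.negPart
  refine ⟨(p.fst + p.snd) + (q.fst + q.snd), inferInstance, fun c => ?_⟩
  have hpq (i j : ι) : inner ℝ (f i) (f j) = p.real (R i ×ˢ R j) - q.real (R i ×ˢ R j) := by
    rw [← hT, ← Measure.toSignedMeasure_sub_apply ((hR i).prod (hR j)),
      ← JordanDecomposition.toSignedMeasure, T.toSignedMeasure_toJordanDecomposition]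
  have hν (E : Set Z) : ((p.fst + p.snd) + (q.fst + q.snd)).real E =
      (p.fst + p.snd).real E + (q.fst + q.snd).real E := measureReal_add_apply
  refine le_of_sq_le_sq ?_ (norm_nonneg _)
  rw [← kernelForm_inner_self, ← kernelForm_inner_self]
  simp only [hpq, inner_indicatorVectorMeasure (hR _) (hR _), kernelForm_sub, hν,
    kernelForm_add]
  linarith [(abs_le.1 (abs_kernelForm_real_prod_le hR p c)).2,
    (abs_le.1 (abs_kernelForm_real_prod_le hR q c)).1]

theorem exists_vectorMeasure_of_gram [CompleteSpace H]
    (hgen : ‹MeasurableSpace Z› = MeasurableSpace.generateFrom (Set.range R))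
    (hpi : IsPiSystem (Set.range R)) (huniv : Set.univ ∈ Set.range R)
    (T : SignedMeasure (Z × Z)) (hT : ∀ i j, T (R i ×ˢ R j) = inner ℝ (f i) (f j)) :
    ∃ ρ : VectorMeasure Z H, ∀ i, ρ (R i) = f i := by
  obtain ⟨ν, _, hν⟩ := exists_norm_linearCombination_le_of_gram
    (fun i => hgen ▸ MeasurableSpace.measurableSet_generateFrom ⟨i, rfl⟩) T hT
  let J := Finsupp.linearCombination ℝ fun i => indicatorVectorMeasure ν (R i)
  let Φ := (Finsupp.linearCombination ℝ f).extendOfNorm J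
  have hΦ (c : ι →₀ ℝ) : Φ (J c) = Finsupp.linearCombination ℝ f c :=
    LinearMap.extendOfNorm_eq
      (denseRange_linearCombination_indicatorVectorMeasure ν hgen hpi huniv)
      ⟨1, fun c => (one_mul ‖J c‖).symm ▸ hν c⟩ c
  refine ⟨(indicatorVectorMeasure ν).mapRange Φ.toLinearMap.toAddMonoidHom Φ.continuous,
    fun i => ?_⟩
  have hΦi : Φ (indicatorVectorMeasure ν (R i)) = f i := by
    simpa [J] using hΦ (Finsupp.single i 1)
  exact hΦi

end Gram

section LocalGram

variable {X Y H : Type*} [MeasurableSpace X] [Bornology X] [MeasurableSpace Y] [Bornology Y]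
  [NormedAddCommGroup H] [InnerProductSpace ℝ H]

theorem exists_extendsOnBox_of_gram [CompleteSpace H] {f : Set X → Set Y → H}
    {S : RealMeasure ((X × Y) × (X × Y))}
    (hS : ∀ A B A' B', IsBoundedBorel A → IsBoundedBorel B → IsBoundedBorel A' →
      IsBoundedBorel B' → S ((A ×ˢ B) ×ˢ (A' ×ˢ B')) = inner ℝ (f A B) (f A' B'))
    {K : Set X} {L : Set Y} (hK : IsBoundedBorel K) (hL : IsBoundedBorel L) :
    ∃ ρ, ExtendsOnBox f K L ρ := by
  let ι := {A : Set X // MeasurableSet A} × {B : Set Y // MeasurableSet B}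
  let R (i : ι) : Set (X × Y) := i.1.1 ×ˢ i.2.1
  have hR (i : ι) : MeasurableSet (R i) := i.1.2.prod i.2.2
  have hrange : Set.range R = Set.image2 (· ×ˢ ·) {A | MeasurableSet A} {B | MeasurableSet B} := by
    ext E
    exact ⟨fun ⟨i, hi⟩ => ⟨i.1, i.1.2, i.2, i.2.2, hi⟩,
      fun ⟨A, hA, B, hB, hE⟩ => ⟨(⟨A, hA⟩, ⟨B, hB⟩), hE⟩⟩
  have hKL := hK.prod hL
  obtain ⟨ρ, hρ⟩ := exists_vectorMeasure_of_gram (R := R)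
    (f := fun i => f (i.1.1 ∩ K) (i.2.1 ∩ L)) (hrange ▸ generateFrom_prod.symm)
    (hrange ▸ isPiSystem_prod) ⟨(⟨Set.univ, .univ⟩, ⟨Set.univ, .univ⟩), Set.univ_prod_univ⟩
    (S.restrict (hKL.prod hKL)) fun i j => by
      rw [LocalVectorMeasure.restrict_apply _ _ ((hR i).prod (hR j)), Set.prod_inter_prod,
        Set.prod_inter_prod, Set.prod_inter_prod,
        hS _ _ _ _ (hK.inter_left i.1.2) (hL.inter_left i.2.2) (hK.inter_left j.1.2)
          (hL.inter_left j.2.2)]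
  refine ⟨ρ, fun A B hA hB hAK hBL => (hρ (⟨A, hA⟩, ⟨B, hB⟩)).trans ?_⟩
  rw [Set.inter_eq_left.2 hAK, Set.inter_eq_left.2 hBL]

namespace LocalVectorMeasure

variable [(Bornology.cobounded X).IsMeasurablyGenerated]
  [(Bornology.cobounded Y).IsMeasurablyGenerated]

theorem exists_of_gram [CompleteSpace H] {f : Set X → Set Y → H}
    {S : RealMeasure ((X × Y) × (X × Y))}
    (hS : ∀ A B A' B', IsBoundedBorel A → IsBoundedBorel B → IsBoundedBorel A' →
      IsBoundedBorel B' → S ((A ×ˢ B) ×ˢ (A' ×ˢ B')) = inner ℝ (f A B) (f A' B')) :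
    ∃ μ : LocalVectorMeasure (X × Y) H,
      (∀ A B, IsBoundedBorel A → IsBoundedBorel B → μ (A ×ˢ B) = f A B) ∧
      ∀ E F, IsBoundedBorel E → IsBoundedBorel F → S (E ×ˢ F) = inner ℝ (μ E) (μ F) := by
  obtain ⟨μ, hμ⟩ := exists_of_forall_extendsOnBox fun K L => exists_extendsOnBox_of_gram hS
  refine ⟨μ, hμ, fun E F => S.isBimeasure.eq_of_forall_prod (isBimeasure_inner μ μ)
    fun A B A' B' hA hB hA' hB' => ?_⟩
  rw [hS A B A' B' hA hB hA' hB', hμ A B hA hB, hμ A' B' hA' hB']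

end LocalVectorMeasure

end LocalGram

namespace RandomMeasure

variable {Ω : Type*} [MeasurableSpace Ω] {P : Measure Ω}
  {X Y : Type*} [MeasurableSpace X] [Bornology X] [MeasurableSpace Y] [Bornology Y]

theorem real_inner_eq_integral_mul (f g : Lp ℝ 2 P) : inner ℝ f g = ∫ ω, f ω * g ω ∂P := by
  simp only [L2.inner_def, RCLike.inner_apply', conj_trivial]

theorem isCrossCovariance_covMeasure (M : RandomMeasure P X) :
    M.IsCrossCovariance M M.covMeasure :=
  fun _ _ hA hB => (M.covMeasure_prod hA hB).symm

section Covariance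

variable [IsProbabilityMeasure P]

theorem meanMeasure_apply (M : RandomMeasure P X) (A : Set X) :
    M.meanMeasure A = ∫ ω, M A ω ∂P := rfl

theorem covariance_lp_eq_sub (f g : Lp ℝ 2 P) :
    cov[f, g; P] = ∫ ω, f ω * g ω ∂P - (∫ ω, f ω ∂P) * ∫ ω, g ω ∂P :=
  covariance_eq_sub (Lp.memLp f) (Lp.memLp g)

variable [(Bornology.cobounded X).IsMeasurablyGenerated]

theorem exists_toLocalVectorMeasure_eq (μ : LocalVectorMeasure X (Lp ℝ 2 P))
    (S : RealMeasure (X × X))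
    (hS : ∀ E F, IsBoundedBorel E → IsBoundedBorel F → S (E ×ˢ F) = inner ℝ (μ E) (μ F)) :
    ∃ M : RandomMeasure P X, M.toLocalVectorMeasure = μ := by
  let m : RealMeasure X :=
    μ.mapRange (innerSL ℝ (indicatorConstLp 2 .univ (measure_ne_top P Set.univ) (1 : ℝ)))
  have hm (E : Set X) : m E = ∫ ω, μ E ω ∂P := by
    rw [LocalVectorMeasure.mapRange_apply, innerSL_apply_apply, L2.inner_indicatorConstLp_one,
      setIntegral_univ]
  let C := S + (m.prod m).mapRange (-ContinuousLinearMap.id ℝ ℝ)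
  have hC (E F : Set X) (hE : IsBoundedBorel E) (hF : IsBoundedBorel F) :
      C (E ×ˢ F) = cov[μ E, μ F; P] := by
    rw [covariance_lp_eq_sub, ← real_inner_eq_integral_mul, ← hS E F hE hF, ← hm, ← hm,
      ← LocalVectorMeasure.prod_apply m m hE hF]
    exact (sub_eq_add_neg _ _).symm
  exact ⟨⟨μ, C, hC⟩, rfl⟩

variable [(Bornology.cobounded Y).IsMeasurablyGenerated]
  {M₁ : RandomMeasure P X} {M₂ : RandomMeasure P Y}

theorem IsCrossCovariance.add_prod_meanMeasure_apply {C : RealMeasure (X × Y)}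
    (hC : M₁.IsCrossCovariance M₂ C) {A : Set X} {B : Set Y} (hA : IsBoundedBorel A)
    (hB : IsBoundedBorel B) :
    (C + M₁.meanMeasure.prod M₂.meanMeasure) (A ×ˢ B) = ∫ ω, M₁ A ω * M₂ B ω ∂P := by
  rw [LocalVectorMeasure.add_apply, ← hC A B hA hB, LocalVectorMeasure.prod_apply _ _ hA hB,
    covariance_lp_eq_sub, meanMeasure_apply, meanMeasure_apply, sub_add_cancel]

end Covariance

variable {M₁ : RandomMeasure P X} {M₂ : RandomMeasure P Y}

theorem JointlyGaussian.integral_mul_mul_mul (h : M₁.JointlyGaussian M₂) {A A' : Set X}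
    {B B' : Set Y} (hA : IsBoundedBorel A) (hB : IsBoundedBorel B) (hA' : IsBoundedBorel A')
    (hB' : IsBoundedBorel B') :
    ∫ ω, M₁ A ω * M₂ B ω * (M₁ A' ω * M₂ B' ω) ∂P =
      (∫ ω, M₁ A ω * M₂ B ω ∂P) * (∫ ω, M₁ A' ω * M₂ B' ω ∂P)
      + (∫ ω, M₁ A ω * M₁ A' ω ∂P) * (∫ ω, M₂ B ω * M₂ B' ω ∂P)
      + (∫ ω, M₁ A ω * M₂ B' ω ∂P) * (∫ ω, M₁ A' ω * M₂ B ω ∂P)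
      - 2 * ((∫ ω, M₁ A ω ∂P) * (∫ ω, M₂ B ω ∂P) *
        ((∫ ω, M₁ A' ω ∂P) * (∫ ω, M₂ B' ω ∂P))) :=
  integral_mul_mul_mul_of_isGaussianProcess h (.inl ⟨A, hA⟩) (.inr ⟨B, hB⟩) (.inl ⟨A', hA'⟩)
    (.inr ⟨B', hB'⟩)

theorem JointlyGaussian.exists_lp_ae_eq_mul (h : M₁.JointlyGaussian M₂) {A : Set X} {B : Set Y}
    (hA : IsBoundedBorel A) (hB : IsBoundedBorel B) :
    ∃ g : Lp ℝ 2 P, g =ᵐ[P] fun ω => M₁ A ω * M₂ B ω :=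
  have hmem : MemLp (fun ω => M₁ A ω * M₂ B ω) 2 P :=
    memLp_mul_of_isGaussianProcess h (.inl ⟨A, hA⟩) (.inr ⟨B, hB⟩)
  ⟨hmem.toLp, hmem.coeFn_toLp⟩

section TensorProduct

variable [IsProbabilityMeasure P] [(Bornology.cobounded X).IsMeasurablyGenerated]
  [(Bornology.cobounded Y).IsMeasurablyGenerated] {C : RealMeasure (X × Y)}

theorem JointlyGaussian.exists_realMeasure_eq_integral_mul (h : M₁.JointlyGaussian M₂)
    (hC : M₁.IsCrossCovariance M₂ C) :
    ∃ S : RealMeasure ((X × Y) × (X × Y)), ∀ A B A' B', IsBoundedBorel A → IsBoundedBorel B →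
      IsBoundedBorel A' → IsBoundedBorel B' → S ((A ×ˢ B) ×ˢ (A' ×ˢ B')) =
        ∫ ω, M₁ A ω * M₂ B ω * (M₁ A' ω * M₂ B' ω) ∂P := by
  let m := M₁.meanMeasure.prod M₂.meanMeasure
  obtain ⟨T, hT⟩ := exists_isReorderedProduct
    (M₁.covMeasure + M₁.meanMeasure.prod M₁.meanMeasure)
    (M₂.covMeasure + M₂.meanMeasure.prod M₂.meanMeasure)
  obtain ⟨T', hT'⟩ := exists_isCrossedProduct (C + m)
  refine ⟨(C + m).prod (C + m) + T + T' + (m.prod m).mapRange (-2 • ContinuousLinearMap.id ℝ ℝ),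
    fun A B A' B' hA hB hA' hB' => ?_⟩
  have hm : (m.prod m).mapRange (-2 • ContinuousLinearMap.id ℝ ℝ) ((A ×ˢ B) ×ˢ (A' ×ˢ B')) =
      -2 * ((∫ ω, M₁ A ω ∂P) * (∫ ω, M₂ B ω ∂P) *
        ((∫ ω, M₁ A' ω ∂P) * (∫ ω, M₂ B' ω ∂P))) := by
    simp [LocalVectorMeasure.mapRange_apply, m, LocalVectorMeasure.prod_apply, hA, hB, hA', hB',
      hA.prod hB, hA'.prod hB', meanMeasure_apply]
  simp only [LocalVectorMeasure.add_apply ((C + m).prod (C + m) + T + T'),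
    LocalVectorMeasure.add_apply ((C + m).prod (C + m) + T),
    LocalVectorMeasure.add_apply ((C + m).prod (C + m)), hm,
    LocalVectorMeasure.prod_apply _ _ (hA.prod hB) (hA'.prod hB'),
    hT A A' B B' hA hA' hB hB', hT' A A' B B' hA hA' hB hB', m]
  rw [h.integral_mul_mul_mul hA hB hA' hB', hC.add_prod_meanMeasure_apply hA hB,
    hC.add_prod_meanMeasure_apply hA' hB', hC.add_prod_meanMeasure_apply hA hB',
    hC.add_prod_meanMeasure_apply hA' hB,
    M₁.isCrossCovariance_covMeasure.add_prod_meanMeasure_apply hA hA',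
    M₂.isCrossCovariance_covMeasure.add_prod_meanMeasure_apply hB hB']
  ring

theorem JointlyGaussian.exists_isTensorProduct (h : M₁.JointlyGaussian M₂)
    (hC : M₁.IsCrossCovariance M₂ C) : ∃ M : RandomMeasure P (X × Y), M₁.IsTensorProduct M₂ M := by
  obtain ⟨S, hS⟩ := h.exists_realMeasure_eq_integral_mul hC
  choose! f hf using fun A B hA hB => h.exists_lp_ae_eq_mul (A := A) (B := B) hA hB
  have hgram : ∀ A B A' B', IsBoundedBorel A → IsBoundedBorel B → IsBoundedBorel A' →
      IsBoundedBorel B' → S ((A ×ˢ B) ×ˢ (A' ×ˢ B')) = inner ℝ (f A B) (f A' B') := by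
    intro A B A' B' hA hB hA' hB'
    rw [hS A B A' B' hA hB hA' hB', real_inner_eq_integral_mul]
    exact integral_congr_ae ((hf A B hA hB).mul (hf A' B' hA' hB')).symm
  obtain ⟨μ, hμf, hμS⟩ := LocalVectorMeasure.exists_of_gram hgram
  obtain ⟨M, rfl⟩ := exists_toLocalVectorMeasure_eq μ S hμS
  exact ⟨M, fun A B hA hB => hμf A B hA hB ▸ hf A B hA hB⟩

namespace IsTensorProduct

variable {M : RandomMeasure P (X × Y)}

theorem meanMeasure_eq (h : M₁.IsTensorProduct M₂ M) (hC : M₁.IsCrossCovariance M₂ C)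
    (h₁ : M₁.IsCentred) : M.meanMeasure = C := by
  refine LocalVectorMeasure.ext_prod fun A B hA hB => ?_
  rw [← hC A B hA hB, covariance_lp_eq_sub, h₁ A hA, zero_mul, sub_zero, meanMeasure_apply]
  exact integral_congr_ae (h A B hA hB)

theorem covMeasure_eq (h : M₁.IsTensorProduct M₂ M) (hG : M₁.JointlyGaussian M₂)
    (hC : M₁.IsCrossCovariance M₂ C) (h₁ : M₁.IsCentred) (h₂ : M₂.IsCentred)
    {T T' : RealMeasure ((X × Y) × (X × Y))}
    (hT : IsReorderedProduct M₁.covMeasure M₂.covMeasure T) (hT' : IsCrossedProduct C T') :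
    M.covMeasure = T + T' := by
  refine LocalVectorMeasure.ext_prod_prod fun A B A' B' hA hB hA' hB' => ?_
  have hmul : ∫ ω, M (A ×ˢ B) ω * M (A' ×ˢ B') ω ∂P =
      ∫ ω, M₁ A ω * M₂ B ω * (M₁ A' ω * M₂ B' ω) ∂P :=
    integral_congr_ae ((h A B hA hB).mul (h A' B' hA' hB'))
  rw [M.covMeasure_prod (hA.prod hB) (hA'.prod hB'), covariance_lp_eq_sub, hmul,
    hG.integral_mul_mul_mul hA hB hA' hB', integral_congr_ae (h A B hA hB),
    integral_congr_ae (h A' B' hA' hB'), LocalVectorMeasure.add_apply,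
    hT A A' B B' hA hA' hB hB', hT' A A' B B' hA hA' hB hB', M₁.covMeasure_prod hA hA',
    M₂.covMeasure_prod hB hB', ← hC A B' hA hB', ← hC A' B hA' hB]
  simp only [covariance_lp_eq_sub, h₁ A hA, h₁ A' hA', h₂ B hB, h₂ B' hB']
  ring

end IsTensorProduct

end TensorProduct

theorem IsTensorProduct.unique [(Bornology.cobounded X).IsMeasurablyGenerated]
    [(Bornology.cobounded Y).IsMeasurablyGenerated] {M M' : RandomMeasure P (X × Y)}
    (h : M₁.IsTensorProduct M₂ M) (h' : M₁.IsTensorProduct M₂ M') : M = M' := by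
  have hMM' : M.toLocalVectorMeasure = M'.toLocalVectorMeasure :=
    LocalVectorMeasure.ext_prod fun A B hA hB => Lp.ext ((h A B hA hB).trans (h' A B hA hB).symm)
  exact RandomMeasure.ext (congrArg LocalVectorMeasure.toFun hMM')

end RandomMeasure

theorem mainTheorem6_general {Ω : Type*} [MeasurableSpace Ω] {P : Measure Ω}
    [IsProbabilityMeasure P] {X Y : Type*} [MeasurableSpace X] [Bornology X]
    [(Bornology.cobounded X).IsMeasurablyGenerated] [MeasurableSpace Y] [Bornology Y]
    [(Bornology.cobounded Y).IsMeasurablyGenerated]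
    {M₁ : RandomMeasure P X} {M₂ : RandomMeasure P Y} (hGauss : M₁.JointlyGaussian M₂)
    {C₁₂ : RealMeasure (X × Y)} (hC₁₂ : M₁.IsCrossCovariance M₂ C₁₂) :
    (∃! M : RandomMeasure P (X × Y), M₁.IsTensorProduct M₂ M) ∧
    (∃! T : RealMeasure ((X × Y) × (X × Y)),
      IsReorderedProduct M₁.covMeasure M₂.covMeasure T) ∧
    (∃! T : RealMeasure ((X × Y) × (X × Y)), IsCrossedProduct C₁₂ T) ∧
    (M₁.IsCentred → M₂.IsCentred → ∀ M T T',
      M₁.IsTensorProduct M₂ M →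
      IsReorderedProduct M₁.covMeasure M₂.covMeasure T → IsCrossedProduct C₁₂ T' →
      M.meanMeasure = C₁₂ ∧ M.covMeasure = T + T') :=
  ⟨existsUnique_of_exists_of_unique (hGauss.exists_isTensorProduct hC₁₂)
      fun _ _ h h' => h.unique h',
    existsUnique_of_exists_of_unique (exists_isReorderedProduct _ _) fun _ _ h h' => h.unique h',
    existsUnique_of_exists_of_unique (exists_isCrossedProduct _) fun _ _ h h' => h.unique h',
    fun h₁ h₂ _ _ _ hM hT hT' =>
      ⟨hM.meanMeasure_eq hC₁₂ h₁, hM.covMeasure_eq hGauss hC₁₂ h₁ h₂ hT hT'⟩⟩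

theorem mainTheorem6 {Ω : Type*} [MeasurableSpace Ω] (P : Measure Ω) [IsProbabilityMeasure P]
    (d p : ℕ)
    (M₁ : RandomMeasure P (EuclideanSpace ℝ (Fin d)))
    (M₂ : RandomMeasure P (EuclideanSpace ℝ (Fin p)))
    (hGauss : M₁.JointlyGaussian M₂)
    (C₁₂ : RealMeasure (EuclideanSpace ℝ (Fin d) × EuclideanSpace ℝ (Fin p)))
    (hC₁₂ : M₁.IsCrossCovariance M₂ C₁₂) :
    (∃! M : RandomMeasure P (EuclideanSpace ℝ (Fin d) × EuclideanSpace ℝ (Fin p)),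
      M₁.IsTensorProduct M₂ M) ∧
    (∃! T : RealMeasure ((EuclideanSpace ℝ (Fin d) × EuclideanSpace ℝ (Fin p)) ×
        (EuclideanSpace ℝ (Fin d) × EuclideanSpace ℝ (Fin p))),
      IsReorderedProduct M₁.covMeasure M₂.covMeasure T) ∧
    (∃! T : RealMeasure ((EuclideanSpace ℝ (Fin d) × EuclideanSpace ℝ (Fin p)) ×
        (EuclideanSpace ℝ (Fin d) × EuclideanSpace ℝ (Fin p))),
      IsCrossedProduct C₁₂ T) ∧
    (M₁.IsCentred → M₂.IsCentred → ∀ M T T',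
      M₁.IsTensorProduct M₂ M →
      IsReorderedProduct M₁.covMeasure M₂.covMeasure T → IsCrossedProduct C₁₂ T' →
      M.meanMeasure = C₁₂ ∧ M.covMeasure = T + T') :=
  mainTheorem6_general hGauss hC₁₂
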